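/- Work in a theory of sets and classes, such as Kelley–Morse class theory with global choice. A vocabulary is a set of finitary relation, function and constant symbols; a structure of a vocabulary $L$ has a non-empty set as its domain. A model class is a class of structures of one vocabulary that is closed under isomorphism. The logic $L_{\infty\infty}=\bigcup_\kappa L_{\kappa^+\kappa^+}$ is built from atomic formulas by negation, conjunctions and disjunctions of arbitrary sets of formulas, and universal and existential quantification over arbitrary sets of variables; a sentence is universal if it consists of universal quantifiers followed by a quantifier-free formula. Vopěnka's Principle says: whenever $\{A_\alpha:\alpha\in\mathrm{On}\}$ is a proper class of structures of the same vocabulary, there are $\alpha\neq\beta$ such that $A_\alpha$ can be embedded into $A_\beta$. **Theorem 16 (Magidor).** The following are equivalent: 1. For every vocabulary $L$ and every model class $\mathcal K$ of $L$-structures which is closed under substructures, there is a universal sentence $\varphi$ of $L_{\infty\infty}$ over $L$ such that $\mathcal K$ is the class of all $L$-structures that satisfy $\varphi$. 2. Vopěnka's Principle. -/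

import Mathlib

open FirstOrder

universe u

/-! Sets are the types in `Type u`, and a vocabulary is a set-sized first-order language (relation,
function and constant symbols). A class is an arbitrary predicate on the (large) type of
structures, as in class theory. -/

/-- A structure (model) of the vocabulary `L`: a non-empty set with an interpretation of `L`. -/
structure Model (L : FirstOrder.Language.{u, u}) : Type (u + 1) where
  carrier : Type u
  [struc : L.Structure carrier]
  [nonempty : Nonempty carrier]

namespace Model

variable {L : FirstOrder.Language.{u, u}}

instance : CoeSort (Model L) (Type u) := ⟨Model.carrier⟩

instance (M : Model L) : L.Structure M := M.struc

instance (M : Model L) : Nonempty M := M.nonempty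

/-- A non-empty substructure of a model, as a model of its own. -/
def ofSubstructure (M : Model L) (S : L.Substructure M) (hS : Nonempty S) : Model L :=
  { carrier := S, nonempty := hS }

end Model

/-- A model class: a class of structures of the same vocabulary closed under isomorphism. -/
def IsModelClass {L : FirstOrder.Language.{u, u}} (K : Set (Model L)) : Prop :=
  ∀ M N : Model L, M ∈ K → Nonempty (M ≃[L] N) → N ∈ K

/-- Closure under (non-empty) substructures. -/
def ClosedUnderSubstructures {L : FirstOrder.Language.{u, u}} (K : Set (Model L)) : Prop :=
  ∀ M ∈ K, ∀ (S : L.Substructure M) (hS : Nonempty S), M.ofSubstructure S hS ∈ K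

/-- Formulas of the infinitary logic `L_{∞∞}` over the vocabulary `L`, with free variables among
the elements of the given set. Conjunctions and disjunctions are taken over arbitrary sets of
formulas, and `all X φ`, `ex X φ` quantify at once over an arbitrary set `X` of new variables. -/
inductive InfFormula (L : FirstOrder.Language.{u, u}) : Type u → Type (u + 1)
  | equal {V : Type u} (s t : L.Term V) : InfFormula L V
  | rel {V : Type u} {n : ℕ} (R : L.Relations n) (ts : Fin n → L.Term V) : InfFormula L V
  | neg {V : Type u} (φ : InfFormula L V) : InfFormula L V
  | conj {V : Type u} (I : Type u) (φ : I → InfFormula L V) : InfFormula L V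
  | disj {V : Type u} (I : Type u) (φ : I → InfFormula L V) : InfFormula L V
  | all {V : Type u} (X : Type u) (φ : InfFormula L (V ⊕ X)) : InfFormula L V
  | ex {V : Type u} (X : Type u) (φ : InfFormula L (V ⊕ X)) : InfFormula L V

namespace InfFormula

variable {L : FirstOrder.Language.{u, u}}

/-- Tarskian satisfaction: `φ.Realize v` means that `φ` holds in `M` under the assignment `v`. -/
def Realize {M : Type u} [L.Structure M] : {V : Type u} → InfFormula L V → (V → M) → Prop
  | _, equal s t, v => s.realize v = t.realize v
  | _, rel R ts, v => FirstOrder.Language.Structure.RelMap R fun i => (ts i).realize v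
  | _, neg φ, v => ¬ φ.Realize v
  | _, conj _ φ, v => ∀ i, (φ i).Realize v
  | _, disj _ φ, v => ∃ i, (φ i).Realize v
  | _, all X φ, v => ∀ x : X → M, φ.Realize (Sum.elim v x)
  | _, ex X φ, v => ∃ x : X → M, φ.Realize (Sum.elim v x)

/-- Quantifier-free formulas. -/
inductive IsQuantifierFree : {V : Type u} → InfFormula L V → Prop
  | equal {V : Type u} (s t : L.Term V) : IsQuantifierFree (equal s t)
  | rel {V : Type u} {n : ℕ} (R : L.Relations n) (ts : Fin n → L.Term V) :
      IsQuantifierFree (rel R ts)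
  | neg {V : Type u} {φ : InfFormula L V} (h : IsQuantifierFree φ) : IsQuantifierFree (neg φ)
  | conj {V : Type u} {I : Type u} {φ : I → InfFormula L V} (h : ∀ i, IsQuantifierFree (φ i)) :
      IsQuantifierFree (conj I φ)
  | disj {V : Type u} {I : Type u} {φ : I → InfFormula L V} (h : ∀ i, IsQuantifierFree (φ i)) :
      IsQuantifierFree (disj I φ)

/-- Universal formulas: universal quantifiers followed by a quantifier-free formula. -/
inductive IsUniversal : {V : Type u} → InfFormula L V → Prop
  | of_quantifierFree {V : Type u} {φ : InfFormula L V} (h : IsQuantifierFree φ) : IsUniversal φ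
  | all {V : Type u} {X : Type u} {φ : InfFormula L (V ⊕ X)} (h : IsUniversal φ) :
      IsUniversal (all X φ)

end InfFormula

/-- Sentences of `L_{∞∞}`: formulas without free variables. -/
abbrev InfSentence (L : FirstOrder.Language.{u, u}) : Type (u + 1) := InfFormula L PEmpty.{u + 1}

/-- The class `Mod(φ)` of all models of the sentence `φ`. -/
def InfSentence.Mod {L : FirstOrder.Language.{u, u}} (φ : InfSentence L) : Set (Model L) :=
  {M | InfFormula.Realize (M := M) φ PEmpty.elim}

/-- Vopěnka's Principle: whenever `{A α : α an ordinal}` is a proper class (is not of the size of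
a set) of structures of the same vocabulary, some `A α` embeds into some `A β` with `α ≠ β`. -/
def VopenkaPrinciple : Prop :=
  ∀ (L : FirstOrder.Language.{u, u}) (A : Ordinal.{u} → Model L), ¬ Small.{u} (Set.range A) →
    ∃ α β : Ordinal.{u}, α ≠ β ∧ Nonempty (A α ↪[L] A β)

/-!
Both directions rest on one observation: a class of models is axiomatized by a universal sentence
of `L_{∞∞}` exactly when it is closed under substructures and membership of a model is decided by
its substructures generated by a bounded number of elements.

A universal sentence that fails in `M` fails in every substructure of `M` containing one tuple of
elements, of a length that depends only on the sentence
(`InfFormula.IsUniversal.exists_bounded_witness`). Given a family `A` of models indexed by the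
ordinals, with no embeddings between distinct members, consider the class of models into which no
`A α` embeds. It is closed under substructures; if a universal sentence axiomatizes it, then each
`A α` has a substructure of bounded cardinality into which some `A β` embeds. Now `β = α`, so the
`A α` have bounded cardinality, and two of them are isomorphic
(`exists_ne_nonempty_equiv_of_card_le`), a contradiction.

Conversely, let `K` be closed under isomorphism and substructures. If a non-empty set `X` is such
that `K` is decided by the substructures generated by families indexed by `X`, then `K` is
axiomatized by the sentence which says that every such family has the atomic diagram of a family in
a member of `K` (`mem_mod_diagramSentence_iff`). If there is no such `X`, recursion on the ordinals
yields models `A α ∉ K` such that all substructures of `A α` of at most the cardinality of some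
earlier model are in `K`. Each `A α` is then of larger cardinality than the earlier
models, so it embeds in none of them, and no earlier model, not being in `K`, embeds in `A α`. This
contradicts Vopěnka's Principle.
-/

open FirstOrder.Language Cardinal

section

variable {L : FirstOrder.Language.{u, u}}

/-! ### Universal sentences and bounded substructures -/

/-- Quantifier-free formulas are absolute between a structure and its substructures. -/
theorem InfFormula.IsQuantifierFree.realize_substructure_iff {M : Type u} [L.Structure M]
    (S : L.Substructure M) {V : Type u} {φ : InfFormula L V} (h : φ.IsQuantifierFree) (v : V → S) :
    φ.Realize (fun i => (v i : M)) ↔ φ.Realize v := by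
  have ht : ∀ {V : Type u} (v : V → S) (t : L.Term V),
      t.realize (fun i => (v i : M)) = ((t.realize v : S) : M) := fun v t =>
    HomClass.realize_term (S.subtype) (t := t) (v := v)
  induction h with
  | equal s t => simp only [Realize, ht, Subtype.coe_inj]
  | rel R ts => simp only [Realize, ht]; rfl
  | neg _ ih => simp only [Realize, ih]
  | conj _ ih => simp only [Realize, ih]
  | disj _ ih => simp only [Realize, ih]

/-- A failure of a universal formula is witnessed by a tuple whose length depends only on the
formula: it persists to all substructures that contain the tuple. -/
theorem InfFormula.IsUniversal.exists_bounded_witness {V : Type u} {φ : InfFormula L V}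
    (h : φ.IsUniversal) :
    ∃ X : Type u, ∀ (M : Type u) [L.Structure M] (v : V → M), ¬ φ.Realize v →
      ∃ x : X → M, ∀ S : L.Substructure M, (∀ i, x i ∈ S) →
        ∀ w : V → S, (∀ i, (w i : M) = v i) → ¬ φ.Realize w := by
  induction h with
  | of_quantifierFree h =>
    refine ⟨PEmpty, fun M _ v hv => ⟨PEmpty.elim, fun S _ w hw hr => hv ?_⟩⟩
    rw [← h.realize_substructure_iff S w] at hr
    rwa [← funext hw]
  | @all V Y φ h ih =>
    obtain ⟨X, hX⟩ := ih
    refine ⟨Y ⊕ X, fun M _ v hv => ?_⟩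
    simp only [Realize, not_forall] at hv
    obtain ⟨y, hy⟩ := hv
    obtain ⟨x, hx⟩ := hX M _ hy
    refine ⟨Sum.elim y x, fun S hS w hw hr => ?_⟩
    refine hx S (fun i => hS (Sum.inr i)) (Sum.elim w fun i => ⟨y i, hS (Sum.inl i)⟩) ?_ (hr _)
    rintro (i | i)
    · exact hw i
    · rfl

/-- A class axiomatized by a universal sentence is decided by substructures of bounded
cardinality. -/
theorem exists_card_bound_of_isUniversal {φ : InfSentence L} (h : φ.IsUniversal) :
    ∃ μ : Cardinal.{u}, ∀ M : Model L, M ∉ φ.Mod →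
      ∃ (S : L.Substructure M) (hS : Nonempty S), #S ≤ μ ∧ M.ofSubstructure S hS ∉ φ.Mod := by
  obtain ⟨X, hX⟩ := h.exists_bounded_witness
  refine ⟨max ℵ₀ (#(Option X) + #(Σ i, L.Functions i)), fun M hM => ?_⟩
  obtain ⟨x, hx⟩ := hX M PEmpty.elim hM
  -- An arbitrary element is added to the witness, which may be empty.
  obtain ⟨m⟩ := M.nonempty
  let y : Option X → M := fun o => o.elim m x
  have hy : ∀ o, y o ∈ Substructure.closure L (Set.range y) := fun o =>
    Substructure.subset_closure ⟨o, rfl⟩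
  refine ⟨Substructure.closure L (Set.range y), ⟨⟨m, hy none⟩⟩, ?_, ?_⟩
  · have := Substructure.lift_card_closure_le (L := L) (s := Set.range y)
    simp only [Cardinal.lift_id] at this
    refine this.trans (max_le_max le_rfl (add_le_add ?_ le_rfl))
    exact mk_range_le
  · exact hx _ (fun i => hy (some i)) _ (fun i => i.elim)

/-- Among class-many structures of bounded cardinality two are isomorphic. -/
theorem exists_ne_nonempty_equiv_of_card_le (A : Ordinal.{u} → Model L) (μ : Cardinal.{u})
    (h : ∀ α, #(A α) ≤ μ) : ∃ α β, α ≠ β ∧ Nonempty (A α ≃[L] A β) := by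
  have he : ∀ α, ∃ s : Set μ.out, Nonempty (A α ≃ s) := fun α => by
    have := h α
    rw [← Cardinal.mk_out μ] at this
    obtain ⟨f⟩ := this
    exact ⟨Set.range f, ⟨Equiv.ofInjective f f.injective⟩⟩
  choose s e using he
  let e' : ∀ α, A α ≃ s α := fun α => (e α).some
  let F : Ordinal.{u} → Σ s : Set μ.out, L.Structure s := fun α =>
    ⟨s α, (e' α).inducedStructure⟩
  have hF := not_injective_of_ordinal F
  simp only [Function.Injective, not_forall] at hF
  obtain ⟨α, β, hαβ, hne⟩ := hF
  refine ⟨α, β, hne, ?_⟩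
  have hs : ∀ γ, Nonempty (@FirstOrder.Language.Equiv L (A γ) (F γ).1 _ (F γ).2) := fun γ =>
    ⟨(e' γ).inducedStructureEquiv⟩
  have h1 := hs α
  rw [hαβ] at h1
  let := (F β).2
  obtain ⟨f⟩ := h1
  obtain ⟨g⟩ := hs β
  exact ⟨g.symm.comp f⟩

theorem vopenkaPrinciple_of_axiomatizable
    (H : ∀ (L : FirstOrder.Language.{u, u}) (K : Set (Model L)),
      IsModelClass K → ClosedUnderSubstructures K →
        ∃ φ : InfSentence L, φ.IsUniversal ∧ K = φ.Mod) : VopenkaPrinciple.{u} := by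
  intro L A _
  by_contra! hA
  let K : Set (Model L) := {M | ∀ α, IsEmpty (A α ↪[L] M)}
  have hK : IsModelClass K := fun M N hM ⟨e⟩ α =>
    ⟨fun f => (hM α).false (e.symm.toEmbedding.comp f)⟩
  have hKsub : ClosedUnderSubstructures K := fun M hM S hS α =>
    ⟨fun f => (hM α).false (Embedding.comp S.subtype f)⟩
  obtain ⟨φ, hφ, hKφ⟩ := H L K hK hKsub
  obtain ⟨μ, hμ⟩ := exists_card_bound_of_isUniversal hφ
  have hcard : ∀ α, #(A α) ≤ μ := by
    intro α
    have hα : A α ∉ K := fun h => (h α).false (Embedding.refl L _)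
    obtain ⟨S, hS, hSμ, hSK⟩ := hμ (A α) (hKφ ▸ hα)
    rw [← hKφ] at hSK
    simp only [K, Set.mem_ofPred_eq, not_forall, not_isEmpty_iff] at hSK
    obtain ⟨β, ⟨f⟩⟩ := hSK
    have hβ : β = α := by
      by_contra hne
      exact (hA β α hne).false (Embedding.comp S.subtype f)
    subst hβ
    exact (mk_le_of_injective (α := A β) (β := S) (f := f) f.injective).trans hSμ
  obtain ⟨α, β, hne, ⟨e⟩⟩ := exists_ne_nonempty_equiv_of_card_le A μ hcard
  exact (hA α β hne).false e.toEmbedding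

/-! ### Axiomatization by atomic diagrams -/

/-- Atomic formulas with variables in `X`, as a set: an equation, or a relation symbol applied to
terms. -/
abbrev AtomicFormula (L : FirstOrder.Language.{u, u}) (X : Type u) : Type u :=
  (L.Term X × L.Term X) ⊕ (Σ n, L.Relations n × (Fin n → L.Term X))

namespace AtomicFormula

/-- An atomic formula as a formula of `L_{∞∞}`. -/
def toInfFormula {X : Type u} : AtomicFormula L X → InfFormula L X
  | Sum.inl (s, t) => .equal s t
  | Sum.inr ⟨_, R, ts⟩ => .rel R ts

theorem isQuantifierFree_toInfFormula {X : Type u} (a : AtomicFormula L X) :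
    a.toInfFormula.IsQuantifierFree := by
  rcases a with ⟨s, t⟩ | ⟨n, R, ts⟩
  · exact .equal s t
  · exact .rel R ts

end AtomicFormula

/-- The atomic diagram of a family of elements: the atomic formulas that it satisfies. -/
def atomicDiagram {X M : Type u} [L.Structure M] (x : X → M) : Set (AtomicFormula L X) :=
  {a | a.toInfFormula.Realize x}

/-- The quantifier-free formula which says that the atomic diagram is `T`: all formulas in `T`
hold, and all others fail. -/
noncomputable def diagramFormula {X : Type u} (T : Set (AtomicFormula L X)) : InfFormula L X :=
  open Classical in
  .conj (AtomicFormula L X) fun a => if a ∈ T then a.toInfFormula else .neg a.toInfFormula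

theorem isQuantifierFree_diagramFormula {X : Type u} (T : Set (AtomicFormula L X)) :
    (diagramFormula T).IsQuantifierFree := by
  refine .conj fun a => ?_
  split_ifs
  · exact a.isQuantifierFree_toInfFormula
  · exact a.isQuantifierFree_toInfFormula.neg

theorem realize_diagramFormula_iff {X M : Type u} [L.Structure M] (T : Set (AtomicFormula L X))
    (x : X → M) : (diagramFormula T).Realize x ↔ atomicDiagram x = T := by
  rw [Set.ext_iff]
  simp only [diagramFormula, InfFormula.Realize]
  refine forall_congr' fun a => ?_
  by_cases ha : a ∈ T <;> simp [ha, atomicDiagram, InfFormula.Realize]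

/-- The universal sentence which says that every family of elements indexed by `X` has the atomic
diagram of a family in some member of `K`. The set of variables is `PEmpty ⊕ X`, since `all` adds
the new variables to the free ones, and a sentence has none. -/
noncomputable def diagramSentence (K : Set (Model L)) (X : Type u) : InfSentence L :=
  .all X <| .disj {T : Set (AtomicFormula L (PEmpty.{u + 1} ⊕ X)) //
      ∃ N ∈ K, ∃ y : PEmpty ⊕ X → N.carrier, atomicDiagram y = T}
    fun T => diagramFormula T.1

theorem isUniversal_diagramSentence (K : Set (Model L)) (X : Type u) :
    (diagramSentence K X).IsUniversal :=
  .all <| .of_quantifierFree <| .disj fun _ => isQuantifierFree_diagramFormula _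

theorem exists_term_of_mem_closure_range {X M : Type u} [L.Structure M] {x : X → M} {m : M}
    (hm : m ∈ Substructure.closure L (Set.range x)) : ∃ t : L.Term X, t.realize x = m := by
  obtain ⟨t, rfl⟩ := Substructure.mem_closure_iff_exists_term.1 hm
  choose g hg using fun i : Set.range x => i.2
  refine ⟨t.relabel g, ?_⟩
  rw [Term.realize_relabel]
  congr 1
  exact funext hg

/-- Families with the same atomic diagram generate isomorphic substructures, so the substructure
generated by the one embeds in the structure of the other. -/
theorem nonempty_embedding_of_atomicDiagram_eq {X M N : Type u} [L.Structure M] [L.Structure N]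
    {x : X → M} {y : X → N} (h : atomicDiagram (L := L) x = atomicDiagram y) :
    Nonempty (Substructure.closure L (Set.range x) ↪[L] N) := by
  have heq : ∀ s t : L.Term X, s.realize x = t.realize x ↔ s.realize y = t.realize y :=
    fun s t => Set.ext_iff.1 h (Sum.inl (s, t))
  have hrel : ∀ {n} (R : L.Relations n) (ts : Fin n → L.Term X),
      Structure.RelMap R (fun i => (ts i).realize x) ↔
        Structure.RelMap R (fun i => (ts i).realize y) :=
    fun R ts => Set.ext_iff.1 h (Sum.inr ⟨_, R, ts⟩)
  choose t ht using fun m : Substructure.closure L (Set.range x) =>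
    exists_term_of_mem_closure_range m.2
  refine ⟨⟨⟨fun m => (t m).realize y, fun m m' hm => ?_⟩, fun {n} f v => ?_, fun {n} R v => ?_⟩⟩
  · have := (heq _ _).2 hm
    rw [ht, ht] at this
    exact Subtype.ext this
  · refine (heq _ (Term.func f fun i => t (v i))).1 ?_
    simp only [ht, Term.realize]
    rfl
  · refine (hrel R fun i => t (v i)).symm.trans ?_
    simp only [ht]
    rfl

/-- If `K` is decided by the substructures generated by families indexed by `X`, it is
axiomatized by its diagram sentence. -/
theorem mem_mod_diagramSentence_iff {K : Set (Model L)} (hK : IsModelClass K)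
    (hsub : ClosedUnderSubstructures K) {X : Type u} [Nonempty X]
    (hX : ∀ M : Model L, (∀ x : X → M, ∀ h : Nonempty (Substructure.closure L (Set.range x)),
      M.ofSubstructure _ h ∈ K) → M ∈ K) (M : Model L) :
    M ∈ (diagramSentence K X).Mod ↔ M ∈ K := by
  simp only [InfSentence.Mod, diagramSentence, Set.mem_ofPred_eq, InfFormula.Realize,
    realize_diagramFormula_iff]
  refine ⟨fun hM => hX M fun x h => ?_, fun hM x => ⟨⟨_, M, hM, _, rfl⟩, rfl⟩⟩
  obtain ⟨⟨_, N, hN, y, rfl⟩, hxy⟩ := hM x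
  have hrange : Set.range (Sum.elim PEmpty.elim x : PEmpty.{u + 1} ⊕ X → M) = Set.range x := by
    rw [Set.Sum.elim_range, Set.range_eq_empty, Set.empty_union]
  have hemb := nonempty_embedding_of_atomicDiagram_eq hxy
  rw [hrange] at hemb
  obtain ⟨f⟩ := hemb
  have hne : Nonempty f.toHom.range := h.map f.equivRange
  exact hK (N.ofSubstructure _ hne) _ (hsub N hN _ hne) ⟨f.equivRange.symm⟩

/-! ### Classes that are not decided by bounded substructures -/

/-- If `K` is not decided by the substructures generated by families of bounded length, then for
each cardinal `κ` there is a model outside `K` all of whose substructures of cardinality at most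
`κ` are in `K`. -/
theorem exists_notMem_forall_card_le_mem {K : Set (Model L)}
    (h : ∀ (X : Type u) [Nonempty X], ∃ M : Model L, M ∉ K ∧
      ∀ x : X → M, ∀ h : Nonempty (Substructure.closure L (Set.range x)),
        M.ofSubstructure _ h ∈ K) (κ : Cardinal.{u}) :
    ∃ M : Model L, M ∉ K ∧ ∀ (S : L.Substructure M) (hS : Nonempty S), #S ≤ κ →
      M.ofSubstructure S hS ∈ K := by
  -- `κ` may be zero, and the index set has to be non-empty.
  obtain ⟨M, hMK, hM⟩ := h (Option κ.out)
  refine ⟨M, hMK, fun S hS hSκ => ?_⟩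
  rw [← mk_out κ] at hSκ
  obtain ⟨f⟩ := hSκ
  let x : Option κ.out → S := fun o => o.elim (Classical.arbitrary S) (Function.invFun f)
  have hsurj : Function.Surjective x := fun m =>
    ⟨some (f m), Function.leftInverse_invFun f.injective m⟩
  have hrange : Set.range (fun o => (x o : M)) = S := by
    rw [Set.range_comp' Subtype.val, hsurj.range_eq]
    simp
  have hmem := hM fun o => (x o : M)
  rw [hrange, Substructure.closure_eq] at hmem
  exact hmem hS

theorem axiomatizable_of_vopenkaPrinciple (hV : VopenkaPrinciple.{u}) (K : Set (Model L))
    (hK : IsModelClass K) (hsub : ClosedUnderSubstructures K) :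
    ∃ φ : InfSentence L, φ.IsUniversal ∧ K = φ.Mod := by
  by_cases h : ∃ (X : Type u) (_ : Nonempty X), ∀ M : Model L,
      (∀ x : X → M, ∀ h : Nonempty (Substructure.closure L (Set.range x)),
        M.ofSubstructure _ h ∈ K) → M ∈ K
  · obtain ⟨X, _, hX⟩ := h
    exact ⟨diagramSentence K X, isUniversal_diagramSentence K X,
      Set.ext fun M => (mem_mod_diagramSentence_iff hK hsub hX M).symm⟩
  exfalso
  have h' : ∀ (X : Type u) [Nonempty X], ∃ M : Model L, M ∉ K ∧
      ∀ x : X → M, ∀ h : Nonempty (Substructure.closure L (Set.range x)),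
        M.ofSubstructure _ h ∈ K := by
    intro X hX
    by_contra! hcon
    refine h ⟨X, hX, fun M hM => ?_⟩
    by_contra hMK
    obtain ⟨x, hx, hxK⟩ := hcon M hMK
    exact hxK (hM x hx)
  choose F hFK hF using exists_notMem_forall_card_le_mem h'
  let A : Ordinal.{u} → Model L := WellFoundedLT.fix fun α A => F (⨆ β : Set.Iio α, #(A β.1 β.2))
  have hA : ∀ α, A α = F (⨆ β : Set.Iio α, #(A β)) := WellFoundedLT.fix_eq _
  have hAK : ∀ α, A α ∉ K := fun α => by
    rw [hA]
    exact hFK _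
  have hsmall : ∀ {β α}, β < α → ∀ (S : L.Substructure (A α)) (hS : Nonempty S),
      #S ≤ #(A β) → (A α).ofSubstructure S hS ∈ K := by
    intro β α hβα S hS hSβ
    have hle : #(A β) ≤ ⨆ β : Set.Iio α, #(A β) :=
      le_ciSup (f := fun β : Set.Iio α => #(A β)) bddAbove_of_small ⟨β, hβα⟩
    have hcard := hSβ.trans hle
    clear hSβ
    revert S
    rw [hA α]
    exact hF _
  have hempty_up : ∀ {β α}, β < α → IsEmpty (A β ↪[L] A α) := by
    refine fun {β α} hβα => ⟨fun f => hAK β ?_⟩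
    have hne : Nonempty f.toHom.range := (A β).nonempty.map f.equivRange
    exact hK _ _ (hsmall hβα _ hne (mk_congr f.equivRange.toEquiv).ge) ⟨f.equivRange.symm⟩
  -- Otherwise `A α`, as a substructure of itself, is small enough to be in `K`.
  have hempty_down : ∀ {β α}, β < α → IsEmpty (A α ↪[L] A β) := by
    refine fun {β α} hβα => ⟨fun f => hAK α ?_⟩
    have hne : Nonempty (⊤ : L.Substructure (A α)) := (A α).nonempty.map fun a => ⟨a, trivial⟩
    refine hK _ _ (hsmall hβα ⊤ hne ?_) ⟨Substructure.topEquiv⟩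
    exact (mk_congr (Substructure.topEquiv (L := L)).toEquiv).le.trans
      (mk_le_of_injective f.injective)
  have hempty : ∀ {α β}, α ≠ β → IsEmpty (A α ↪[L] A β) := fun h =>
    h.lt_or_gt.elim hempty_up hempty_down
  have hinj : Function.Injective A := by
    intro α β hαβ
    by_contra hne
    exact (hempty hne).false (hαβ ▸ Embedding.refl L (A α))
  obtain ⟨α, β, hne, ⟨f⟩⟩ := hV L A fun hs =>
    not_injective_of_ordinal (Set.rangeFactorization A) (hinj.codRestrict _)
  exact (hempty hne).false f

end

theorem theorem16 :
    (∀ (L : FirstOrder.Language.{u, u}) (K : Set (Model L)),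
      IsModelClass K → ClosedUnderSubstructures K →
        ∃ φ : InfSentence L, φ.IsUniversal ∧ K = φ.Mod) ↔
    VopenkaPrinciple.{u} :=
  ⟨vopenkaPrinciple_of_axiomatizable, fun hV _ => axiomatizable_of_vopenkaPrinciple hV⟩
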